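/- Fix an integer $m\ge 1$ and let $G_n=G_n^m$ be the preferential attachment multigraph: $G_1$ is a single node $1$ with $m$ self-loops; $G_t$ is obtained from $G_{t-1}$ by adding the node $t$ together with $m$ edges $(t,v_1),\dots,(t,v_m)$ inserted one after the other, where, if $M$ denotes the sum of the degrees of all nodes (including $t$) just before an edge is inserted, its endpoint is a node $v<t$ with probability $\deg(v)/(M+1)$ and is $t$ itself with probability $(\deg(t)+1)/(M+1)$ (degrees are the current ones; a self-loop counts twice). Then, with probability tending to $1$ as $n\to\infty$, the random sequence of graphs $G_1\subseteq\dots\subseteq G_n$ is such that the following holds simultaneously for all nodes $u\in\{1,\dots,n\}$ and all arrival times $i\in\{2,\dots,n\}$ with $i\neq u$: the conditional probability, given the graph $G_{\max\{u,i\}-1}$ present just before the later of the two nodes $u$ and $i$ arrives, that $u$ is adjacent to the node $i$ arriving at time $i$ is at most $$\frac{\max\{d,\log^3 n\}}{i-1}.$$ Here $\log$ is the natural logarithm and $d$ is the degree of $u$ in $G_s$, for any time $s$ with $\max\{u,i-1\}\le s\le n$; in particular $d$ may be taken to be the final degree of $u$ in $G_n$, or, if $i$ arrives after $u$, the degree of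 $u$ just before $i$ arrives. -/

import Mathlib

open Filter Topology MeasureTheory ProbabilityTheory
open scoped ENNReal

noncomputable section

/-- Multigraphs (loops and parallel edges allowed) on nodes labelled `1, 2, 3, …` in their order
of arrival, given by their multiset of edges. An edge is stored as `(new node, chosen endpoint)`. -/
abbrev PAGraph := Multiset (ℕ × ℕ)

instance instMeasurableSpacePAGraph : MeasurableSpace PAGraph := ⊤

namespace PAGraph

/-- The degree of the node `v`; a loop counts twice. -/
def deg (G : PAGraph) (v : ℕ) : ℕ :=
  (G.map Prod.fst).count v + (G.map Prod.snd).count v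

/-- Some edge joins `u` and `v`. -/
def Adjacent (G : PAGraph) (u v : ℕ) : Prop :=
  (u, v) ∈ G ∨ (v, u) ∈ G

/-- The subgraph induced on the nodes `1, …, t`. For a graph grown by preferential attachment this
is the graph as it was after `t` steps, since the edges inserted with node `k` join `k` to nodes
`v ≤ k`. -/
def upTo (G : PAGraph) (t : ℕ) : PAGraph :=
  G.filter (fun e => e.1 ≤ t ∧ e.2 ≤ t)

/-- The sum of the degrees of the nodes `1, …, u`. -/
def totalDeg (u : ℕ) (G : PAGraph) : ℕ :=
  ∑ v ∈ Finset.Icc 1 u, G.deg v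

/-- The probability with which `v` is selected as the endpoint of the next edge of the newest
node `u`: it is `deg v / (M + 1)` for `v < u` and `(deg u + 1) / (M + 1)` for `v = u`. -/
def endpointProb (u : ℕ) (G : PAGraph) (v : ℕ) : ℝ≥0∞ :=
  if v ∈ Finset.Icc 1 u then
    ((G.deg v + if v = u then 1 else 0 : ℕ) : ℝ≥0∞) / ((totalDeg u G + 1 : ℕ) : ℝ≥0∞)
  else 0

theorem sum_endpointProb (u : ℕ) (hu : 1 ≤ u) (G : PAGraph) :
    ∑ v ∈ Finset.Icc 1 u, endpointProb u G v = 1 := by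
  have h : ∑ v ∈ Finset.Icc 1 u, (G.deg v + if v = u then 1 else 0) = totalDeg u G + 1 := by
    rw [Finset.sum_add_distrib, Finset.sum_ite_eq', if_pos (Finset.mem_Icc.2 ⟨hu, le_rfl⟩)]
    rfl
  have h2 : ∀ v ∈ Finset.Icc 1 u, endpointProb u G v
      = ((G.deg v + if v = u then 1 else 0 : ℕ) : ℝ≥0∞) * ((totalDeg u G + 1 : ℕ) : ℝ≥0∞)⁻¹ := by
    intro v hv
    rw [endpointProb, if_pos hv, div_eq_mul_inv]
  rw [Finset.sum_congr rfl h2, ← Finset.sum_mul, ← Nat.cast_sum, h]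
  exact ENNReal.mul_inv_cancel (Nat.cast_ne_zero.2 (Nat.succ_ne_zero _)) (ENNReal.natCast_ne_top _)

/-- The random endpoint of the next edge of the newest node `u`. -/
def endpoint (u : ℕ) (hu : 1 ≤ u) (G : PAGraph) : PMF ℕ :=
  PMF.ofFinset (endpointProb u G) (Finset.Icc 1 u) (sum_endpointProb u hu G)
    (fun _ hv => if_neg hv)

/-- Insert `k` edges at the newest node `u`, one after the other. -/
def addEdges (u : ℕ) (hu : 1 ≤ u) : ℕ → PAGraph → PMF PAGraph
  | 0, G => PMF.pure G
  | k + 1, G => (endpoint u hu G).bind fun v => addEdges u hu k ((u, v) ::ₘ G)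

/-- The law of the preferential attachment graph `G_n^m`. (For `n = 0`: the empty graph.) -/
def law (m : ℕ) : ℕ → PMF PAGraph
  | 0 => PMF.pure 0
  | 1 => PMF.pure (Multiset.replicate m (1, 1))
  | n + 2 => (law m (n + 1)).bind fun G => addEdges (n + 2) (Nat.le_add_left 1 (n + 1)) m G

/-- Let `t = max u i` be the time at which the later of the two nodes `u`, `i` arrives. This is the
conditional probability, in the random graph `G_n^m`, that `u` and `i` are adjacent, given that
after `t - 1` steps (just before the later of them arrives) the graph was the one that `G` was. -/
def arrivalProb (m n : ℕ) (G : PAGraph) (u i : ℕ) : ℝ :=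
  (cond (law m n).toMeasure {H | H.upTo (max u i - 1) = G.upTo (max u i - 1)}).real
    {H | H.Adjacent u i}

end PAGraph

end

/-! Each of the `m` edges inserted with the later node finds a total degree of at least `2mt`, where
`t` is the number of earlier steps. A union bound therefore makes an older node `a` a neighbour with
conditional probability at most `deg a / (2t)` (`cond_law_adjacent_le`). If `u` is the older node
this suffices, since degrees only grow. If `i` is the older node, then `t = u - 1` and the claim
needs `deg i ≤ 2t log³ n / (i - 1)` after `t` steps. With `X` the degree of `i` and `M` the total
degree, `X(X+1)⋯(X+K-1) / M^K` is a supermartingale once `i` has arrived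
(`expect_potential_cons_le`). Markov's inequality gives the tail `((2m + K) / L)^K`
(`toMeasure_lt_deg_le`). For `L = log³ n` and `K = ⌈log n⌉` this is eventually at most `n⁻³`, which
survives a union bound over at most `n²` pairs `(i, t)`. -/

namespace PAGraph

/-- The expectation of `f` under `p`. -/
noncomputable def expect {α : Type*} (p : PMF α) (f : α → ℝ≥0∞) : ℝ≥0∞ := ∑' x, p x * f x

/-! ### Expectations under a `PMF` -/

section Expect

variable {α β : Type*}

theorem expect_pure (a : α) (f : α → ℝ≥0∞) : expect (PMF.pure a) f = f a := by
  rw [expect, tsum_eq_single a]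
  · simp
  · intro b hb
    simp [PMF.pure_apply, hb]

theorem expect_bind (p : PMF α) (q : α → PMF β) (f : β → ℝ≥0∞) :
    expect (p.bind q) f = expect p fun a => expect (q a) f := by
  simp only [expect, PMF.bind_apply, ← ENNReal.tsum_mul_right, ← ENNReal.tsum_mul_left]
  rw [ENNReal.tsum_comm]
  simp only [mul_assoc]

theorem expect_mono {p : PMF α} {f g : α → ℝ≥0∞} (h : ∀ x ∈ p.support, f x ≤ g x) :
    expect p f ≤ expect p g := by
  refine ENNReal.tsum_le_tsum fun x => ?_
  by_cases hx : p x = 0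
  · simp [hx]
  · exact mul_le_mul_right (h x ((p.mem_support_iff x).2 hx)) _

theorem expect_congr {p : PMF α} {f g : α → ℝ≥0∞} (h : ∀ x ∈ p.support, f x = g x) :
    expect p f = expect p g :=
  le_antisymm (expect_mono fun x hx => (h x hx).le) (expect_mono fun x hx => (h x hx).ge)

theorem expect_const (p : PMF α) (c : ℝ≥0∞) : expect p (fun _ => c) = c := by
  rw [expect, ENNReal.tsum_mul_right, p.tsum_coe, one_mul]

theorem expect_le {p : PMF α} {f : α → ℝ≥0∞} {c : ℝ≥0∞} (h : ∀ x ∈ p.support, f x ≤ c) :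
    expect p f ≤ c :=
  (expect_mono h).trans_eq (expect_const p c)

theorem expect_mul_right (p : PMF α) (f : α → ℝ≥0∞) (c : ℝ≥0∞) :
    expect p (fun x => f x * c) = expect p f * c := by
  simp only [expect, ← mul_assoc, ENNReal.tsum_mul_right]

theorem expect_add (p : PMF α) (f g : α → ℝ≥0∞) :
    expect p (fun x => f x + g x) = expect p f + expect p g := by
  simp only [expect, mul_add, ENNReal.tsum_add]

theorem expect_ite_eq [DecidableEq α] (p : PMF α) (a : α) (c : ℝ≥0∞) :
    expect p (fun x => if x = a then c else 0) = p a * c := by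
  rw [expect, tsum_eq_single a]
  · simp
  · intro b hb
    simp [hb]

theorem toMeasure_eq_expect [MeasurableSpace α] [DiscreteMeasurableSpace α] (p : PMF α)
    (s : Set α) : p.toMeasure s = expect p (s.indicator 1) := by
  rw [PMF.toMeasure_apply _ (MeasurableSet.of_discrete), expect]
  refine tsum_congr fun x => ?_
  by_cases hx : x ∈ s <;> simp [hx]

end Expect

/-! ### Degrees, restrictions and the support of the growth process -/

instance : DiscreteMeasurableSpace PAGraph := ⟨fun _ => trivial⟩

/-- All edges of `G` join nodes among `1, …, t`. -/
def Within (t : ℕ) (G : PAGraph) : Prop :=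
  ∀ e ∈ G, e.1 ∈ Finset.Icc 1 t ∧ e.2 ∈ Finset.Icc 1 t

theorem Within.mono {s t : ℕ} (hst : s ≤ t) {G : PAGraph} (h : G.Within s) : G.Within t := by
  intro e he
  have := h e he
  simp only [Finset.mem_Icc] at this ⊢
  omega

theorem Within.cons {t v : ℕ} {G : PAGraph} (h : G.Within t) (ht : 1 ≤ t)
    (hv : v ∈ Finset.Icc 1 t) : Within t ((t, v) ::ₘ G) := by
  intro e he
  rcases Multiset.mem_cons.1 he with rfl | he
  · exact ⟨Finset.mem_Icc.2 ⟨ht, le_rfl⟩, hv⟩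
  · exact h e he

theorem Within.upTo_eq {t : ℕ} {G : PAGraph} (h : G.Within t) : G.upTo t = G := by
  refine Multiset.filter_eq_self.2 fun e he => ?_
  have := h e he
  simp only [Finset.mem_Icc] at this
  omega

theorem Within.totalDeg_eq {t : ℕ} {G : PAGraph} (h : G.Within t) :
    totalDeg t G = 2 * Multiset.card G := by
  have h1 : ∑ v ∈ Finset.Icc 1 t, (G.map Prod.fst).count v = Multiset.card (G.map Prod.fst) :=
    Multiset.sum_count_eq_card fun a ha => by
      obtain ⟨e, he, rfl⟩ := Multiset.mem_map.1 ha
      exact (h e he).1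
  have h2 : ∑ v ∈ Finset.Icc 1 t, (G.map Prod.snd).count v = Multiset.card (G.map Prod.snd) :=
    Multiset.sum_count_eq_card fun a ha => by
      obtain ⟨e, he, rfl⟩ := Multiset.mem_map.1 ha
      exact (h e he).2
  simp only [totalDeg, deg, Finset.sum_add_distrib, h1, h2, Multiset.card_map]
  omega

theorem deg_cons (e : ℕ × ℕ) (G : PAGraph) (a : ℕ) :
    deg (e ::ₘ G) a = G.deg a + (if a = e.1 then 1 else 0) + (if a = e.2 then 1 else 0) := by
  simp only [deg, Multiset.map_cons, Multiset.count_cons]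
  omega

theorem deg_mono {G H : PAGraph} (h : G ≤ H) (a : ℕ) : G.deg a ≤ H.deg a :=
  add_le_add (Multiset.count_le_of_le _ (Multiset.map_le_map h))
    (Multiset.count_le_of_le _ (Multiset.map_le_map h))

theorem upTo_mono (G : PAGraph) {s t : ℕ} (h : s ≤ t) : G.upTo s ≤ G.upTo t :=
  Multiset.monotone_filter_right _ fun _ he => ⟨he.1.trans h, he.2.trans h⟩

theorem upTo_upTo (G : PAGraph) {s t : ℕ} (h : s ≤ t) : (G.upTo t).upTo s = G.upTo s := by
  rw [upTo, upTo, upTo, Multiset.filter_filter]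
  refine Multiset.filter_congr fun e _ => ?_
  omega

theorem adjacent_upTo (G : PAGraph) {u v t : ℕ} (hu : u ≤ t) (hv : v ≤ t) :
    (G.upTo t).Adjacent u v ↔ G.Adjacent u v := by
  simp [Adjacent, upTo, hu, hv]

theorem endpoint_apply (u : ℕ) (hu : 1 ≤ u) (G : PAGraph) (v : ℕ) :
    endpoint u hu G v = endpointProb u G v := rfl

theorem mem_Icc_of_mem_support_endpoint {u : ℕ} {hu : 1 ≤ u} {G : PAGraph} {v : ℕ}
    (h : v ∈ (endpoint u hu G).support) : v ∈ Finset.Icc 1 u := by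
  by_contra hv
  rw [PMF.mem_support_iff, endpoint_apply, endpointProb, if_neg hv] at h
  exact h rfl

theorem endpoint_apply_of_lt {u a : ℕ} (hu : 1 ≤ u) {G : PAGraph} (hG : G.Within u) (ha : 1 ≤ a)
    (hau : a < u) :
    endpoint u hu G a = (G.deg a : ℝ≥0∞) / ((2 * Multiset.card G + 1 : ℕ) : ℝ≥0∞) := by
  rw [endpoint_apply, endpointProb, if_pos (Finset.mem_Icc.2 ⟨ha, hau.le⟩),
    if_neg hau.ne, add_zero, hG.totalDeg_eq]

theorem exists_of_mem_support_addEdges {u : ℕ} {hu : 1 ≤ u} {k : ℕ} {G H : PAGraph}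
    (h : H ∈ (addEdges u hu k G).support) :
    ∃ S : PAGraph, Multiset.card S = k ∧ (∀ e ∈ S, e.1 = u ∧ e.2 ∈ Finset.Icc 1 u) ∧
      H = S + G := by
  induction k generalizing G with
  | zero =>
    rw [addEdges, PMF.support_pure, Set.mem_singleton_iff] at h
    exact ⟨0, rfl, by simp, by simp [h]⟩
  | succ k ih =>
    rw [addEdges, PMF.mem_support_bind_iff] at h
    obtain ⟨v, hv, hH⟩ := h
    obtain ⟨S, hc, hS, rfl⟩ := ih hH
    refine ⟨(u, v) ::ₘ S, by simp [hc], ?_, by simp⟩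
    intro e he
    rcases Multiset.mem_cons.1 he with rfl | he
    · exact ⟨rfl, mem_Icc_of_mem_support_endpoint hv⟩
    · exact hS e he

theorem upTo_of_mem_support_addEdges {u : ℕ} {hu : 1 ≤ u} {k : ℕ} {G H : PAGraph}
    (h : H ∈ (addEdges u hu k G).support) {t : ℕ} (ht : t < u) : H.upTo t = G.upTo t := by
  obtain ⟨S, -, hS, rfl⟩ := exists_of_mem_support_addEdges h
  rw [upTo, Multiset.filter_add, Multiset.filter_eq_nil.2, zero_add, upTo]
  intro e he
  have := (hS e he).1
  omega

theorem within_of_mem_support_addEdges {u : ℕ} {hu : 1 ≤ u} {k : ℕ} {G H : PAGraph}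
    (hG : G.Within u) (h : H ∈ (addEdges u hu k G).support) : H.Within u := by
  obtain ⟨S, -, hS, rfl⟩ := exists_of_mem_support_addEdges h
  intro e he
  rcases Multiset.mem_add.1 he with he | he
  · exact ⟨by rw [(hS e he).1]; exact Finset.mem_Icc.2 ⟨hu, le_rfl⟩, (hS e he).2⟩
  · exact hG e he

theorem law_succ (m : ℕ) {n : ℕ} (hn : 1 ≤ n) :
    law m (n + 1) = (law m n).bind fun G => addEdges (n + 1) (Nat.le_add_left 1 n) m G := by
  obtain ⟨k, rfl⟩ := Nat.exists_eq_add_of_le' hn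
  rfl

theorem of_mem_support_law {m t : ℕ} {G : PAGraph} (h : G ∈ (law m t).support) :
    Multiset.card G = m * t ∧ G.Within t := by
  induction t generalizing G with
  | zero =>
    rw [law, PMF.support_pure, Set.mem_singleton_iff] at h
    subst h
    exact ⟨rfl, fun e he => absurd he (Multiset.notMem_zero e)⟩
  | succ t ih =>
    rcases Nat.eq_zero_or_pos t with rfl | ht
    · rw [law, PMF.support_pure, Set.mem_singleton_iff] at h
      subst h
      refine ⟨by simp, fun e he => ?_⟩
      rw [Multiset.eq_of_mem_replicate he]
      simp
    · rw [law_succ m ht, PMF.mem_support_bind_iff] at h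
      obtain ⟨K, hK, hG⟩ := h
      obtain ⟨hc, hW⟩ := ih hK
      refine ⟨?_, within_of_mem_support_addEdges (hW.mono (Nat.le_succ t)) hG⟩
      obtain ⟨S, hS, -, rfl⟩ := exists_of_mem_support_addEdges hG
      rw [Multiset.card_add, hS, hc]
      ring

/-- The first `t` steps of the graph after `n` steps are distributed as the graph after `t`
steps. -/
theorem expect_law_upTo (m : ℕ) {t n : ℕ} (ht : 1 ≤ t) (htn : t ≤ n) (f : PAGraph → ℝ≥0∞) :
    expect (law m n) (fun G => f (G.upTo t)) = expect (law m t) f := by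
  induction n, htn using Nat.le_induction with
  | base => exact expect_congr fun G hG => by rw [(of_mem_support_law hG).2.upTo_eq]
  | succ n hn ih =>
    rw [law_succ m (ht.trans hn), expect_bind, ← ih]
    refine expect_congr fun G _ => ?_
    rw [← expect_const (addEdges (n + 1) (Nat.le_add_left 1 n) m G) (f (G.upTo t))]
    exact expect_congr fun H hH => by
      rw [upTo_of_mem_support_addEdges hH (Nat.lt_succ_of_le hn)]

theorem toMeasure_law_upTo (m : ℕ) {t n : ℕ} (ht : 1 ≤ t) (htn : t ≤ n) (s : Set PAGraph) :
    (law m n).toMeasure {G | G.upTo t ∈ s} = (law m t).toMeasure s := by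
  rw [toMeasure_eq_expect, toMeasure_eq_expect, ← expect_law_upTo m ht htn]
  rfl

/-! ### Conditional probability of adjacency -/

theorem natCast_div_le_div {a b c d : ℕ} (hb : 0 < b) (hd : 0 < d) (h : a * d ≤ c * b) :
    (a : ℝ≥0∞) / b ≤ (c : ℝ≥0∞) / d := by
  have hb' : (b : ℝ≥0∞) ≠ 0 := Nat.cast_ne_zero.2 hb.ne'
  have hd' : (d : ℝ≥0∞) ≠ 0 := Nat.cast_ne_zero.2 hd.ne'
  rw [ENNReal.div_le_iff hb' (ENNReal.natCast_ne_top b), ← ENNReal.mul_div_right_comm,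
    ENNReal.le_div_iff_mul_le (Or.inl hd') (Or.inl (ENNReal.natCast_ne_top d))]
  exact_mod_cast h

/-- A node `a` older than `u` receives one of `k` edges inserted at `u` with probability at most
`k deg a / M`, if `M` is at most the total degree. -/
theorem expect_addEdges_adjacent_le {u a : ℕ} (hu : 1 ≤ u) (ha : 1 ≤ a) (hau : a < u) {M : ℕ}
    (k : ℕ) {G : PAGraph} (hG : G.Within u) (hc : M ≤ 2 * Multiset.card G)
    (hadj : ¬ G.Adjacent a u) :
    expect (addEdges u hu k G) (Set.indicator {H | H.Adjacent a u} 1)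
      ≤ ((k * G.deg a : ℕ) : ℝ≥0∞) / (M : ℝ≥0∞) := by
  induction k generalizing G with
  | zero =>
    rw [addEdges, expect_pure, Set.indicator_of_notMem (by exact hadj)]
    exact zero_le
  | succ k ih =>
    rw [addEdges, expect_bind]
    calc _ ≤ expect (endpoint u hu G) (fun v => (if v = a then 1 else 0) +
          ((k * G.deg a : ℕ) : ℝ≥0∞) / (M : ℝ≥0∞)) := by
          refine expect_mono fun v hv => ?_
          by_cases hva : v = a
          -- After a hit the remaining edges are bounded trivially by probability 1.
          · rw [if_pos hva]
            refine le_add_right (expect_le fun H _ => ?_)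
            exact Set.indicator_apply_le' (fun _ => le_rfl) fun _ => zero_le
          · rw [if_neg hva, zero_add]
            -- A miss leaves `deg a` unchanged and the fixed `M` remains a lower bound, so the
            -- induction hypothesis has the same ratio.
            have hd : deg ((u, v) ::ₘ G) a = G.deg a := by
              simp [deg_cons, hau.ne, Ne.symm hva]
            rw [← hd]
            refine ih (hG.cons hu (mem_Icc_of_mem_support_endpoint hv)) ?_ ?_
            · rw [Multiset.card_cons]; omega
            · simp only [Adjacent, Multiset.mem_cons, Prod.mk.injEq, not_or] at hadj ⊢
              exact ⟨⟨fun h => hau.ne h.1, hadj.1⟩, fun h => hva h.2.symm, hadj.2⟩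
      _ = (G.deg a : ℝ≥0∞) / ((2 * Multiset.card G + 1 : ℕ) : ℝ≥0∞) +
          ((k * G.deg a : ℕ) : ℝ≥0∞) / (M : ℝ≥0∞) := by
          rw [expect_add, expect_const, expect_ite_eq, mul_one, endpoint_apply_of_lt hu hG ha hau]
      _ ≤ (G.deg a : ℝ≥0∞) / (M : ℝ≥0∞) + ((k * G.deg a : ℕ) : ℝ≥0∞) / (M : ℝ≥0∞) := by
          gcongr
          omega
      _ = _ := by
          rw [← ENNReal.add_div]
          congr 1
          push_cast
          ring

/-- In the law of the graph after `t + 1` steps, given that the graph was `K` after `t` steps, the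
newest node is adjacent to `a` with probability at most `deg a / (2 t)`. -/
theorem toMeasure_law_adjacent_le {m : ℕ} (hm : 1 ≤ m) {n t a : ℕ} (ht : 1 ≤ t) (htn : t + 1 ≤ n)
    (ha : 1 ≤ a) (hat : a ≤ t) (K : PAGraph) :
    (law m n).toMeasure ({H | H.upTo t = K} ∩ {H | H.Adjacent a (t + 1)})
      ≤ (law m n).toMeasure {H | H.upTo t = K} * ((K.deg a : ℝ≥0∞) / ((2 * t : ℕ) : ℝ≥0∞)) := by
  have h1 : (law m n).toMeasure {H | H.upTo t = K} = law m t K := by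
    have := toMeasure_law_upTo m ht ((Nat.le_succ t).trans htn) {K}
    simp only [Set.mem_singleton_iff] at this
    rw [this, PMF.toMeasure_apply_singleton _ _ (MeasurableSet.of_discrete)]
  -- The event depends only on the first `t + 1` steps, so the law after `t + 1` steps decides it.
  have h2 : ({H | H.upTo t = K} ∩ {H | H.Adjacent a (t + 1)} : Set PAGraph) =
      {H | H.upTo (t + 1) ∈ ({H | H.upTo t = K} ∩ {H | H.Adjacent a (t + 1)} : Set PAGraph)} := by
    ext H
    simp only [Set.mem_inter_iff, Set.mem_ofPred_eq, upTo_upTo H (Nat.le_succ t),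
      adjacent_upTo H (Nat.le_succ_of_le hat) le_rfl]
  rw [h1, h2, toMeasure_law_upTo m (Nat.le_add_left 1 t) htn, toMeasure_eq_expect, law_succ m ht,
    expect_bind, ← expect_ite_eq]
  refine expect_mono fun G hG => ?_
  obtain ⟨hc, hW⟩ := of_mem_support_law hG
  split_ifs with hGK
  · subst hGK
    have hadj : ¬ G.Adjacent a (t + 1) := by
      rintro (h | h)
      · have := (hW _ h).2
        simp at this
      · have := (hW _ h).1
        simp at this
    have hM : 0 < m * (2 * t) := Nat.mul_pos hm (by omega)
    refine (expect_mono fun H _ => ?_).trans ((expect_addEdges_adjacent_le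
      (Nat.le_add_left 1 t) ha (Nat.lt_succ_of_le hat) m (hW.mono (Nat.le_succ t))
      (by rw [hc]; exact le_of_eq (by ring)) hadj).trans
        (natCast_div_le_div hM (by omega) (le_of_eq (by ring))))
    exact Set.indicator_le_indicator_of_subset Set.inter_subset_right (fun _ => zero_le) H
  · refine expect_le fun H hH => ?_
    rw [Set.indicator_of_notMem]
    rintro ⟨h, -⟩
    rw [Set.mem_ofPred_eq, upTo_of_mem_support_addEdges hH (Nat.lt_succ_self t), hW.upTo_eq] at h
    exact hGK h

theorem cond_law_adjacent_le {m : ℕ} (hm : 1 ≤ m) {n t a : ℕ} (ht : 1 ≤ t) (htn : t + 1 ≤ n)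
    (ha : 1 ≤ a) (hat : a ≤ t) (K : PAGraph) :
    (cond (law m n).toMeasure {H | H.upTo t = K}).real {H | H.Adjacent a (t + 1)}
      ≤ (K.deg a : ℝ) / (2 * t) := by
  have h : cond (law m n).toMeasure {H | H.upTo t = K} {H | H.Adjacent a (t + 1)}
      ≤ (K.deg a : ℝ≥0∞) / ((2 * t : ℕ) : ℝ≥0∞) := by
    rw [cond_apply (MeasurableSet.of_discrete)]
    refine (mul_le_mul_right (toMeasure_law_adjacent_le hm ht htn ha hat K) _).trans ?_
    rw [← mul_assoc]
    -- `x⁻¹ * x ≤ 1` holds also for `x = 0`, which covers conditioning on a null event.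
    exact mul_le_of_le_one_left zero_le (ENNReal.inv_mul_le_one _)
  have ht' : ((2 * t : ℕ) : ℝ≥0∞) ≠ 0 := Nat.cast_ne_zero.2 (by omega)
  refine (ENNReal.toReal_mono (ENNReal.div_ne_top (ENNReal.natCast_ne_top _) ht') h).trans_eq ?_
  rw [ENNReal.toReal_div, ENNReal.toReal_natCast, ENNReal.toReal_natCast]
  push_cast
  rfl

theorem adjacent_comm (G : PAGraph) (u v : ℕ) : G.Adjacent u v ↔ G.Adjacent v u := or_comm

theorem arrivalProb_le_of_lt {m : ℕ} (hm : 1 ≤ m) {n u i : ℕ} (hu : 1 ≤ u) (hui : u < i)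
    (hin : i ≤ n) (G : PAGraph) :
    arrivalProb m n G u i ≤ ((G.upTo (i - 1)).deg u : ℝ) / (2 * ((i : ℝ) - 1)) := by
  obtain ⟨t, rfl⟩ : ∃ t, i = t + 1 := ⟨i - 1, by omega⟩
  rw [arrivalProb, max_eq_right hui.le, Nat.add_sub_cancel]
  refine (cond_law_adjacent_le hm (by omega) hin hu (by omega) _).trans_eq ?_
  push_cast
  ring_nf

theorem arrivalProb_comm (m n : ℕ) (G : PAGraph) (u i : ℕ) :
    arrivalProb m n G u i = arrivalProb m n G i u := by
  simp only [arrivalProb, max_comm u i, adjacent_comm _ u i]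

/-! ### Degree tails from rising factorial moments -/

/-- The potential whose expectation does not increase when an edge is inserted. -/
noncomputable def potential (K a : ℕ) (G : PAGraph) : ℝ≥0∞ :=
  ((G.deg a).ascFactorial K : ℝ≥0∞) / (((2 * Multiset.card G) ^ K : ℕ) : ℝ≥0∞)

/-- A Bernoulli-type inequality: the expected growth `1 + K / (M + 1)` of the rising factorial is at
most the growth `((M + 2) / M)^K` of the normalisation. -/
theorem add_mul_pow_le (M K : ℕ) : (M + 1 + K) * M ^ K ≤ (M + 1) * (M + 2) ^ K := by
  induction K with
  | zero => simp
  | succ K ih =>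
    calc (M + 1 + (K + 1)) * M ^ (K + 1) = ((M + 1 + K) * M + M) * M ^ K := by ring
      _ ≤ ((M + 1 + K) * (M + 2)) * M ^ K := by gcongr; nlinarith
      _ = ((M + 1 + K) * M ^ K) * (M + 2) := by ring
      _ ≤ ((M + 1) * (M + 2) ^ K) * (M + 2) := by gcongr
      _ = _ := by ring

/-- A hit has probability `X / (M + 1)` and raises the rising factorial by the fraction `K / X` of
itself, so the factor `X` cancels in the mean. -/
theorem expect_potential_cons_le (K : ℕ) {u a : ℕ} (hu : 1 ≤ u) (ha : 1 ≤ a) (hau : a < u)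
    {G : PAGraph} (hG : G.Within u) (hc : 0 < Multiset.card G) :
    expect (endpoint u hu G) (fun v => potential K a ((u, v) ::ₘ G)) ≤ potential K a G := by
  set X := G.deg a with hX
  set M := 2 * Multiset.card G with hM
  have hM0 : 0 < M := by omega
  obtain ⟨δ, hδ⟩ : ∃ δ, (X + 1).ascFactorial K = X.ascFactorial K + δ :=
    Nat.exists_eq_add_of_le (Nat.ascFactorial_le K (Nat.le_succ X))
  -- Multiplied out, the increment identity needs no case distinction at `X = 0`.
  have hXδ : X * δ = K * X.ascFactorial K := by
    have := Nat.succ_ascFactorial X K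
    rw [Nat.succ_eq_add_one, hδ] at this
    linarith
  have hpot : ∀ v, potential K a ((u, v) ::ₘ G) =
      ((X.ascFactorial K : ℝ≥0∞) + if v = a then (δ : ℝ≥0∞) else 0) *
        (((M + 2) ^ K : ℕ) : ℝ≥0∞)⁻¹ := by
    intro v
    rw [potential, deg_cons, Multiset.card_cons, if_neg hau.ne, add_zero, ← hX, mul_add, ← hM,
      div_eq_mul_inv, mul_one]
    by_cases hva : v = a
    · simp [hva, hδ]
    · simp [hva, Ne.symm hva]
  simp only [hpot]
  rw [expect_mul_right, expect_add, expect_const, expect_ite_eq, endpoint_apply_of_lt hu hG ha hau,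
    ← hX, ← hM, potential, ← hX, ← hM, ← div_eq_mul_inv, ← ENNReal.mul_div_right_comm]
  have hM1 : ((M + 1 : ℕ) : ℝ≥0∞) ≠ 0 := Nat.cast_ne_zero.2 (Nat.succ_ne_zero M)
  have e : (X.ascFactorial K : ℝ≥0∞) + (X : ℝ≥0∞) * (δ : ℝ≥0∞) / ((M + 1 : ℕ) : ℝ≥0∞) =
      (((M + 1 + K) * X.ascFactorial K : ℕ) : ℝ≥0∞) / ((M + 1 : ℕ) : ℝ≥0∞) := by
    rw [← Nat.cast_mul X δ, hXδ, ENNReal.eq_div_iff hM1 (ENNReal.natCast_ne_top _), mul_add,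
      ENNReal.mul_div_cancel hM1 (ENNReal.natCast_ne_top _)]
    push_cast
    ring
  rw [e, div_eq_mul_inv, div_eq_mul_inv, mul_assoc, ← ENNReal.mul_inv (Or.inl hM1)
    (Or.inl (ENNReal.natCast_ne_top _)), ← Nat.cast_mul, ← div_eq_mul_inv]
  refine natCast_div_le_div (by positivity) (by positivity) ?_
  calc (M + 1 + K) * X.ascFactorial K * M ^ K
      = X.ascFactorial K * ((M + 1 + K) * M ^ K) := by ring
    _ ≤ X.ascFactorial K * ((M + 1) * (M + 2) ^ K) :=
      Nat.mul_le_mul_left _ (add_mul_pow_le M K)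

theorem expect_potential_addEdges_le (K k : ℕ) {u a : ℕ} (hu : 1 ≤ u) (ha : 1 ≤ a) (hau : a < u)
    {G : PAGraph} (hG : G.Within u) (hc : 0 < Multiset.card G) :
    expect (addEdges u hu k G) (potential K a) ≤ potential K a G := by
  induction k generalizing G with
  | zero => rw [addEdges, expect_pure]
  | succ k ih =>
    rw [addEdges, expect_bind]
    refine (expect_mono fun v hv => ?_).trans (expect_potential_cons_le K hu ha hau hG hc)
    exact ih (hG.cons hu (mem_Icc_of_mem_support_endpoint hv)) (by simp)

/-- Node `i` has degree 0 before it arrives, and each of its `m` edges contributes at most 2. -/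
theorem deg_self_le {m i : ℕ} (hi : 2 ≤ i) {G : PAGraph} (hG : G ∈ (law m i).support) :
    G.deg i ≤ 2 * m := by
  obtain ⟨t, rfl⟩ : ∃ t, i = t + 1 := ⟨i - 1, by omega⟩
  rw [law_succ m (by omega), PMF.mem_support_bind_iff] at hG
  obtain ⟨H, hH, hG⟩ := hG
  obtain ⟨S, hS, -, rfl⟩ := exists_of_mem_support_addEdges hG
  have hW := (of_mem_support_law hH).2
  have h0 : H.deg (t + 1) = 0 := by
    rw [deg, Multiset.count_eq_zero_of_notMem, Multiset.count_eq_zero_of_notMem]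
    · intro h
      obtain ⟨e, he, h⟩ := Multiset.mem_map.1 h
      have := (hW e he).2
      simp [h] at this
    · intro h
      obtain ⟨e, he, h⟩ := Multiset.mem_map.1 h
      have := (hW e he).1
      simp [h] at this
  have h1 : deg (S + H) (t + 1) = S.deg (t + 1) + H.deg (t + 1) := by
    simp only [deg, Multiset.map_add, Multiset.count_add]
    omega
  have h2 := Multiset.count_le_card (t + 1) (S.map Prod.fst)
  have h3 := Multiset.count_le_card (t + 1) (S.map Prod.snd)
  rw [Multiset.card_map] at h2 h3
  rw [h1, h0, deg]
  omega

theorem expect_potential_law_le (K : ℕ) {m : ℕ} (hm : 1 ≤ m) {i t : ℕ} (hi : 2 ≤ i)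
    (hit : i ≤ t) :
    expect (law m t) (potential K i)
      ≤ ((2 * m).ascFactorial K : ℝ≥0∞) / (((2 * (m * i)) ^ K : ℕ) : ℝ≥0∞) := by
  induction t, hit using Nat.le_induction with
  | base =>
    refine expect_le fun G hG => ?_
    rw [potential, (of_mem_support_law hG).1]
    gcongr
    exact deg_self_le hi hG
  | succ t hit ih =>
    rw [law_succ m (by omega), expect_bind]
    refine (expect_mono fun G hG => ?_).trans ih
    obtain ⟨hc, hW⟩ := of_mem_support_law hG
    refine expect_potential_addEdges_le K m _ (by omega) (by omega) (hW.mono (Nat.le_succ t)) ?_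
    rw [hc]
    exact Nat.mul_pos hm (by omega)

/-- The tail of the degree of the node `i` after `t` steps. -/
theorem toMeasure_lt_deg_le (K : ℕ) {m : ℕ} (hm : 1 ≤ m) {i t n : ℕ} (hi : 2 ≤ i) (hit : i ≤ t)
    (htn : t ≤ n) {L : ℝ} (hL : 0 < L) :
    (law m n).toMeasure {G | 2 * (t : ℝ) * L / ((i : ℝ) - 1) < ((G.upTo t).deg i : ℝ)}
      ≤ ENNReal.ofReal (((2 * m + K) / L) ^ K) := by
  have hm' : (0 : ℝ) < m := by exact_mod_cast hm
  have hi' : (0 : ℝ) < (i : ℝ) - 1 := by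
    have : (2 : ℝ) ≤ i := by exact_mod_cast hi
    linarith
  have hi0 : (0 : ℝ) < i := by linarith
  have ht : (0 : ℝ) < t := hi0.trans_le (by exact_mod_cast hit)
  -- The inverse of the potential's threshold `(2tL / i)^K / (2mt)^K`, with `i - 1` relaxed to `i`;
  -- Markov's inequality multiplies by it.
  set c : ℝ := (m * i / L) ^ K with hc
  have hc0 : 0 ≤ c := by positivity
  have h1 : (law m n).toMeasure {G | 2 * (t : ℝ) * L / ((i : ℝ) - 1) < ((G.upTo t).deg i : ℝ)} =
      (law m t).toMeasure {G | 2 * (t : ℝ) * L / ((i : ℝ) - 1) < (G.deg i : ℝ)} :=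
    toMeasure_law_upTo m (by omega) htn {G | 2 * (t : ℝ) * L / ((i : ℝ) - 1) < (G.deg i : ℝ)}
  have h2 : (law m t).toMeasure {G | 2 * (t : ℝ) * L / ((i : ℝ) - 1) < (G.deg i : ℝ)} ≤
      expect (law m t) (fun G => potential K i G * ENNReal.ofReal c) := by
    rw [toMeasure_eq_expect]
    refine expect_mono fun G hG => Set.indicator_apply_le' (fun h => ?_) fun _ => zero_le
    rw [Set.mem_ofPred_eq] at h
    have hM : 0 < (2 * (m * t)) ^ K := by
      have : 0 < t := by omega
      positivity
    have hd : 2 * (t : ℝ) * L / i ≤ G.deg i := by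
      refine le_trans ?_ h.le
      gcongr
      linarith
    rw [potential, (of_mem_support_law hG).1, Pi.one_apply, ← ENNReal.ofReal_natCast,
      ← ENNReal.ofReal_natCast, ← ENNReal.ofReal_div_of_pos (by exact_mod_cast hM),
      ← ENNReal.ofReal_mul (by positivity), ENNReal.one_le_ofReal]
    have hx : (2 * (t : ℝ) * L / i) ^ K ≤ ((G.deg i).ascFactorial K : ℝ) := by
      calc _ ≤ (G.deg i : ℝ) ^ K := by gcongr
        _ ≤ _ := by exact_mod_cast Nat.pow_succ_le_ascFactorial _ K
    calc (1 : ℝ) = (2 * (t : ℝ) * L / i) ^ K / ((2 * (m * t)) ^ K) * c := by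
          rw [hc, ← div_pow, ← mul_pow]
          rw [show 2 * (t : ℝ) * L / i / (2 * (m * t)) * (m * i / L) = 1 by field_simp, one_pow]
      _ ≤ _ := by
          push_cast
          gcongr
  rw [h1]
  refine h2.trans ?_
  rw [expect_mul_right]
  have hM : 0 < (2 * (m * i)) ^ K := by positivity
  refine (mul_le_mul_left (expect_potential_law_le K hm hi hit) _).trans ?_
  rw [← ENNReal.ofReal_natCast,
      ← ENNReal.ofReal_natCast, ← ENNReal.ofReal_div_of_pos (by exact_mod_cast hM),
      ← ENNReal.ofReal_mul (by positivity)]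
  refine ENNReal.ofReal_le_ofReal ?_
  have hx : ((2 * m).ascFactorial K : ℝ) ≤ (2 * m + K) ^ K := by
    exact_mod_cast (Nat.ascFactorial_le K (Nat.le_succ (2 * m))).trans
      (Nat.ascFactorial_le_pow_add (2 * m) K)
  calc _ ≤ (2 * (m : ℝ) + K) ^ K / ((2 * (m * i)) ^ K) * c := by
        push_cast
        gcongr
    _ = ((2 * (m : ℝ) + K) / (2 * L)) ^ K := by
        rw [hc, ← div_pow, ← mul_pow]
        congr 1
        field_simp
    _ ≤ _ := by
        gcongr
        linarith

/-! ### Choice of the moment and union bound -/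

theorem eventually_pow_le (m : ℕ) :
    ∀ᶠ n : ℕ in atTop, 0 < Real.log n ∧
      ((2 * m + (⌈Real.log n⌉₊ : ℝ)) / Real.log n ^ 3) ^ ⌈Real.log n⌉₊ ≤ ((n : ℝ)⁻¹) ^ 3 := by
  have hlog : Tendsto (fun n : ℕ => Real.log n) atTop atTop :=
    Real.tendsto_log_atTop.comp tendsto_natCast_atTop_atTop
  filter_upwards [hlog.eventually_ge_atTop (2 * m + 1 + Real.exp 3), eventually_ge_atTop 1]
    with n hn hn1
  set x := Real.log n with hx
  have he : 1 ≤ Real.exp 3 := Real.one_le_exp (by norm_num)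
  have hm : (0 : ℝ) ≤ m := Nat.cast_nonneg m
  have hx0 : 0 < x := by linarith
  have hn0 : (0 : ℝ) < n := by exact_mod_cast hn1
  refine ⟨hx0, ?_⟩
  have hK1 := Nat.le_ceil x
  have hK2 := Nat.ceil_lt_add_one hx0.le
  -- With `x ≥ 2m + 1 + e³` the numerator is at most `x²`, and the spare factor `x` exceeds `e³`.
  have h1 : (2 * m + (⌈x⌉₊ : ℝ)) / x ^ 3 ≤ Real.exp (-3) := by
    rw [Real.exp_neg, ← one_div, div_le_div_iff₀ (by positivity) (by positivity), one_mul]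
    have h2 : 2 * m + (⌈x⌉₊ : ℝ) ≤ x * x := by nlinarith
    calc _ ≤ (x * x) * x := by gcongr; linarith
      _ = _ := by ring
  calc _ ≤ Real.exp (-3) ^ ⌈x⌉₊ := by gcongr
    _ = Real.exp (-(⌈x⌉₊ : ℝ)) ^ 3 := by
      rw [← Real.exp_nat_mul, ← Real.exp_nat_mul]
      congr 1
      push_cast
      ring
    _ ≤ Real.exp (-x) ^ 3 := by gcongr
    _ = _ := by rw [Real.exp_neg, hx, Real.exp_log hn0]

/-- The graphs in which at some time `t` some node `i` has too large a degree. -/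
def highDegree (n : ℕ) : Set PAGraph :=
  ⋃ i ∈ Finset.Icc 2 n, ⋃ t ∈ Finset.Icc i n,
    {G | 2 * (t : ℝ) * Real.log n ^ 3 / ((i : ℝ) - 1) < ((G.upTo t).deg i : ℝ)}

theorem eventually_toMeasure_highDegree_le {m : ℕ} (hm : 1 ≤ m) :
    ∀ᶠ n : ℕ in atTop, (law m n).toMeasure (highDegree n) ≤ ENNReal.ofReal ((n : ℝ)⁻¹) := by
  filter_upwards [eventually_pow_le m, eventually_ge_atTop 1] with n ⟨hlog, hn⟩ hn1
  have hn0 : (0 : ℝ) < n := by exact_mod_cast hn1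
  have hcard : ∀ i ∈ Finset.Icc 2 n, (Finset.Icc i n).card ≤ n := fun i hi => by
    rw [Finset.mem_Icc] at hi
    rw [Nat.card_Icc]
    omega
  calc (law m n).toMeasure (highDegree n)
      ≤ ∑ i ∈ Finset.Icc 2 n, ∑ t ∈ Finset.Icc i n, ENNReal.ofReal (((n : ℝ)⁻¹) ^ 3) := by
        refine (measure_biUnion_finset_le _ _).trans (Finset.sum_le_sum fun i hi => ?_)
        refine (measure_biUnion_finset_le _ _).trans (Finset.sum_le_sum fun t ht => ?_)
        rw [Finset.mem_Icc] at hi ht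
        exact (toMeasure_lt_deg_le _ hm hi.1 ht.1 ht.2 (by positivity)).trans
          (ENNReal.ofReal_le_ofReal hn)
    _ ≤ ∑ i ∈ Finset.Icc 2 n, (n : ℝ≥0∞) * ENNReal.ofReal (((n : ℝ)⁻¹) ^ 3) := by
        refine Finset.sum_le_sum fun i hi => ?_
        rw [Finset.sum_const, nsmul_eq_mul]
        gcongr
        exact hcard i hi
    _ ≤ (n : ℝ≥0∞) * ((n : ℝ≥0∞) * ENNReal.ofReal (((n : ℝ)⁻¹) ^ 3)) := by
        rw [Finset.sum_const, nsmul_eq_mul]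
        gcongr
        rw [Nat.card_Icc]
        omega
    _ = ENNReal.ofReal ((n : ℝ)⁻¹) := by
        rw [← ENNReal.ofReal_natCast, ← ENNReal.ofReal_mul hn0.le, ← ENNReal.ofReal_mul hn0.le]
        congr 1
        field_simp

/-! ### Conclusion -/

theorem arrivalProb_le_of_notMem_highDegree {m : ℕ} (hm : 1 ≤ m) {n : ℕ} {G : PAGraph}
    (hG : G ∉ highDegree n) {u i s : ℕ} (hu : u ∈ Finset.Icc 1 n) (hi : i ∈ Finset.Icc 2 n)
    (hui : u ≠ i) (hs : s ∈ Finset.Icc (max u (i - 1)) n) :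
    arrivalProb m n G u i
      ≤ max ((G.upTo s).deg u : ℝ) (Real.log n ^ 3) / ((i : ℝ) - 1) := by
  rw [Finset.mem_Icc] at hu hi hs
  have hi' : (0 : ℝ) < (i : ℝ) - 1 := by
    have : (2 : ℝ) ≤ i := by exact_mod_cast hi.1
    linarith
  rcases lt_or_gt_of_ne hui with h | h
  · refine (arrivalProb_le_of_lt hm hu.1 h hi.2 G).trans ?_
    have hd : ((G.upTo (i - 1)).deg u : ℝ) ≤ (G.upTo s).deg u := by
      exact_mod_cast deg_mono (G.upTo_mono ((le_max_right _ _).trans hs.1)) u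
    gcongr
    · exact hd.trans (le_max_left _ _)
    · linarith
  · rw [arrivalProb_comm]
    refine (arrivalProb_le_of_lt hm (by omega) h hu.2 G).trans ?_
    -- The excluded event is used at time `u - 1 ≥ i`; its factor `2(u - 1)` cancels the denominator
    -- of the adjacency bound.
    have hd : ((G.upTo (u - 1)).deg i : ℝ) ≤
        2 * ((u - 1 : ℕ) : ℝ) * Real.log n ^ 3 / ((i : ℝ) - 1) := by
      by_contra! hlt
      refine hG (Set.mem_biUnion (Finset.mem_Icc.2 hi)
        (Set.mem_biUnion (x := u - 1) (Finset.mem_Icc.2 ⟨by omega, by omega⟩) hlt))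
    have hu1 : (0 : ℝ) < (u : ℝ) - 1 := by
      have : (i : ℝ) < u := by exact_mod_cast h
      linarith
    rw [Nat.cast_sub hu.1, Nat.cast_one] at hd
    calc _ ≤ 2 * ((u : ℝ) - 1) * Real.log n ^ 3 / ((i : ℝ) - 1) / (2 * ((u : ℝ) - 1)) := by
          gcongr
      _ = Real.log n ^ 3 / ((i : ℝ) - 1) := by field_simp
      _ ≤ _ := by
          gcongr
          exact le_max_right _ _

end PAGraph

theorem mainTheorem10 (m : ℕ) (hm : 1 ≤ m) :
    Tendsto
      (fun n : ℕ => (PAGraph.law m n).toMeasure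
        {G : PAGraph | ∀ u ∈ Finset.Icc 1 n, ∀ i ∈ Finset.Icc 2 n, u ≠ i →
          ∀ s ∈ Finset.Icc (max u (i - 1)) n,
            PAGraph.arrivalProb m n G u i
              ≤ max ((G.upTo s).deg u : ℝ) (Real.log n ^ 3) / ((i : ℝ) - 1)})
      atTop (𝓝 1) := by
  have h0 : Tendsto (fun n : ℕ => 1 - ENNReal.ofReal ((n : ℝ)⁻¹)) atTop (𝓝 1) := by
    have h := ENNReal.tendsto_ofReal (tendsto_inv_atTop_nhds_zero_nat (𝕜 := ℝ))
    have h' := ENNReal.Tendsto.sub (tendsto_const_nhds (x := (1 : ℝ≥0∞))) h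
      (Or.inl ENNReal.one_ne_top)
    simpa using h'
  refine tendsto_of_tendsto_of_tendsto_of_le_of_le' h0 tendsto_const_nhds ?_
    (Eventually.of_forall fun n => prob_le_one)
  filter_upwards [PAGraph.eventually_toMeasure_highDegree_le hm] with n hn
  calc 1 - ENNReal.ofReal ((n : ℝ)⁻¹)
      ≤ 1 - (PAGraph.law m n).toMeasure (PAGraph.highDegree n) := tsub_le_tsub_left hn 1
    _ = (PAGraph.law m n).toMeasure (PAGraph.highDegree n)ᶜ :=
        (prob_compl_eq_one_sub (MeasurableSet.of_discrete)).symm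
    _ ≤ _ := by
        refine measure_mono fun G hG => ?_
        rw [Set.mem_ofPred_eq]
        intro u hu i hi hui s hs
        exact PAGraph.arrivalProb_le_of_notMem_highDegree hm hG hu hi hui hs
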